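/- Let $T$ be a topological semigroup with a neutral element $e$ (a monoid with jointly continuous multiplication), let $X$ be a compact Hausdorff space with its unique compatible uniform structure $\mathscr U_X$, and let $(T,X)$ be a semiflow, i.e. a jointly continuous map $T\times X\to X$, $(t,x)\mapsto tx$, with $ex=x$ and $(ts)x=t(sx)$ for all $s,t\in T$ and $x\in X$. Suppose that: 1. $T$ is a right C-semigroup: for every $s\in T$ the set $T\setminus Ts$ is relatively compact in $T$ (its closure is compact); 2. $(T,X)$ is syndetically transitive: for all non-empty open sets $U,V\subseteq X$ the set $N_T(U,V)=\{t\in T : U\cap t^{-1}V\neq\emptyset\}$ is syndetic in $T$, where $A\subseteq T$ is called syndetic if there is a compact set $K\subseteq T$ with $Kt\cap A\neq\emptyset$ for every $t\in T$; 3. $(T,X)$ is weakly almost periodic: for every $f\in C(X,\mathbb R)$ the set $Tf=\{f_t : t\in T\}$, where $f_t(x)=f(tx)$, is relatively compact in $C(X,\mathbb R)$ with the topology of pointwise convergence. Then $(T,X)$ is minimal, i.e. the orbit $Tx$ of every $x\in X$ is dense in $X$, and it is equicontinuous, i.e. for every $\varepsilon\in\mathscr U_X$ there is $\delta\in\mathscr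 U_X$ such that $(x,y)\in\delta$ implies $(tx,ty)\in\varepsilon$ for all $t\in T$. -/

import Mathlib

open scoped Uniformity

namespace WAPSemiflow

/-- The topology of pointwise convergence on `C(X, ℝ)`, i.e. the one induced from the product
topology on `X → ℝ`. -/
abbrev pointwiseTopology (X : Type*) [TopologicalSpace X] : TopologicalSpace C(X, ℝ) :=
  TopologicalSpace.induced (fun (g : C(X, ℝ)) (x : X) => g x) Pi.topologicalSpace

section

variable (T : Type*) [Monoid T] [TopologicalSpace T]

/-- A subset `A` of a topological monoid `T` is syndetic if there is a compact `K ⊆ T` such that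
`K t` meets `A` for every `t`. -/
def IsSyndetic {T : Type*} [Monoid T] [TopologicalSpace T] (A : Set T) : Prop :=
  ∃ K : Set T, IsCompact K ∧ ∀ t : T, ((fun k : T => k * t) '' K ∩ A).Nonempty

/-- A right C-semigroup: `T \ T s` is relatively compact in `T` for every `s`. -/
def IsRightCSemigroup : Prop :=
  ∀ s : T, IsCompact (closure ((Set.range (fun t : T => t * s))ᶜ))

variable (X : Type*) [TopologicalSpace X] [MulAction T X]

/-- The hitting-time set `N_T(U, V) = {t | U ∩ t⁻¹ V ≠ ∅}`. -/
def hittingTimes {X : Type*} [MulAction T X] (U V : Set X) : Set T :=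
  {t : T | (U ∩ (fun x : X => t • x) ⁻¹' V).Nonempty}

/-- Syndetic transitivity of the semiflow `(T, X)`. -/
def IsSyndeticallyTransitive : Prop :=
  ∀ U V : Set X, IsOpen U → IsOpen V → U.Nonempty → V.Nonempty →
    IsSyndetic (hittingTimes T U V)

/-- For `f ∈ C(X, ℝ)` and `t ∈ T`, the function `f_t : x ↦ f (t x)`. -/
def translate {T X : Type*} [Monoid T] [TopologicalSpace T] [TopologicalSpace X] [MulAction T X]
    [ContinuousSMul T X] (f : C(X, ℝ)) (t : T) : C(X, ℝ) :=
  ⟨fun x => f (t • x), f.continuous.comp (continuous_const_smul t)⟩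

/-- Weak almost periodicity: for every `f ∈ C(X, ℝ)` the set `T f = {f_t | t ∈ T}` is relatively
compact in `C(X, ℝ)` with the topology of pointwise convergence. -/
def IsWeaklyAlmostPeriodic [ContinuousSMul T X] : Prop :=
  ∀ f : C(X, ℝ),
    @IsCompact C(X, ℝ) (pointwiseTopology X)
      (@closure C(X, ℝ) (pointwiseTopology X) (Set.range (fun t : T => translate f t)))

end

end WAPSemiflow

open Set Filter Topology

namespace WAPSemiflow

/-! Weak almost periodicity yields, for each `f` and `ε`, a nonempty open `W` on which all
translates of `f` oscillate by at most `ε` (`exists_open_oscillation_le`, a double-limit argument).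
Transitivity spreads this: a non-dense orbit would force two points of one such `W` apart. By
minimality every `x` is then moved into `W` by some `s`; times in `T s` are controlled by `W`, the
others by compactness of the closure of their complement. Testing on all `f` gives equicontinuity.
-/

/-- If every nonempty open set carries an oscillation greater than `3 * ε` of some member of a
uniformly bounded family, then every nonempty open `V` has an open subset on which two members,
`δ`-close at finitely many prescribed points, differ by at least `ε`. -/
theorem exists_close_on_finset_far_on_open {ι X : Type*} [TopologicalSpace X] [RegularSpace X]
    (h : ι → C(X, ℝ)) {M ε δ : ℝ} (hM : ∀ i x, |h i x| ≤ M) (hε : 0 < ε) (hδ : 0 < δ)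
    (hosc : ∀ W : Set X, IsOpen W → W.Nonempty → ∃ i, ∃ x ∈ W, ∃ y ∈ W, 3 * ε < |h i x - h i y|)
    (s : Finset X) {V : Set X} (hV : IsOpen V) (hVne : V.Nonempty) :
    ∃ i j, (∀ x ∈ s, |h i x - h j x| < δ) ∧ ∃ U : Set X, IsOpen U ∧ U.Nonempty ∧
      closure U ⊆ V ∧ ∀ x ∈ closure U, ε ≤ |h i x - h j x| := by
  suffices H : ∃ i j, (∀ x ∈ s, |h i x - h j x| < δ) ∧ ∃ x ∈ V, ε < |h i x - h j x| by
    obtain ⟨i, j, hs, x, hxV, hx⟩ := H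
    refine ⟨i, j, hs, ?_⟩
    have hO : IsOpen (V ∩ {y | ε < |h i y - h j y|}) :=
      hV.inter (isOpen_lt continuous_const (by fun_prop))
    obtain ⟨C, hC, hCc, hCs⟩ := exists_mem_nhds_isClosed_subset (hO.mem_nhds ⟨hxV, hx⟩)
    have hcl : closure (interior C) ⊆ C := closure_minimal interior_subset hCc
    exact ⟨interior C, isOpen_interior, ⟨x, mem_interior_iff_mem_nhds.2 hC⟩,
      fun y hy => (hCs (hcl hy)).1, fun y hy => (hCs (hcl hy)).2.le⟩
  by_contra! H
  obtain ⟨x₀, hx₀⟩ := hVne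
  have : Nonempty ι := ⟨(hosc V hV ⟨x₀, hx₀⟩).choose⟩
  have htb : TotallyBounded (range fun i => fun x : s => h i x) := by
    refine (isCompact_closedBall (0 : s → ℝ) (max M 0)).totallyBounded.subset ?_
    rintro _ ⟨i, rfl⟩
    rw [mem_closedBall_zero_iff, pi_norm_le_iff_of_nonneg (le_max_right _ _)]
    exact fun x => (hM i x).trans (le_max_left _ _)
  -- Finitely many members form a `δ`-net on `s`. If each member stayed within `ε` of its net
  -- approximant on `V`, then near `x₀`, where net members vary by less than `ε`, every oscillation
  -- would be at most `3 * ε`.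
  obtain ⟨c, hc, hcf, hcov⟩ := totallyBounded_iff_subset.1 htb _ (Metric.dist_mem_uniformity hδ)
  choose! g hg using fun p (hp : p ∈ c) => mem_range.1 (hc hp)
  have hWo : IsOpen (V ∩ ⋂ p ∈ c, {y | |h (g p) y - h (g p) x₀| < ε / 2}) :=
    hV.inter (hcf.isOpen_biInter fun p _ => isOpen_lt (by fun_prop) continuous_const)
  obtain ⟨i, x, hx, y, hy, hxy⟩ := hosc _ hWo ⟨x₀, hx₀, by simp [hε]⟩
  obtain ⟨p, hp, hip⟩ := mem_iUnion₂.1 (hcov ⟨i, rfl⟩)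
  have hclose : ∀ z ∈ s, |h i z - h (g p) z| < δ := fun z hz => by
    have := (dist_pi_lt_iff hδ).1 hip ⟨z, hz⟩
    rw [← hg p hp] at this
    exact this
  have h₁ := H i (g p) hclose x hx.1
  have h₂ := H i (g p) hclose y hy.1
  have h₃ := mem_iInter₂.1 hx.2 p hp
  have h₄ := mem_iInter₂.1 hy.2 p hp
  simp only [mem_ofPred_eq, abs_lt, abs_le] at h₁ h₂ h₃ h₄
  refine hxy.not_ge (abs_le.2 ⟨?_, ?_⟩) <;> linarith

/-- A uniformly bounded family of continuous functions on a nonempty compact regular space that is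
relatively compact for the topology of pointwise convergence has uniformly small oscillation on
some nonempty open set. -/
theorem exists_open_oscillation_le {ι X : Type*} [TopologicalSpace X] [CompactSpace X]
    [RegularSpace X] [Nonempty X] (h : ι → C(X, ℝ)) {M ε : ℝ} (hM : ∀ i x, |h i x| ≤ M)
    (hlim : ∀ 𝒰 : Ultrafilter ι, ∃ g : C(X, ℝ), ∀ x, Tendsto (fun i => h i x) 𝒰 (𝓝 (g x)))
    (hε : 0 < ε) :
    ∃ W : Set X, IsOpen W ∧ W.Nonempty ∧ ∀ i, ∀ x ∈ W, ∀ y ∈ W, |h i x - h i y| ≤ ε := by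
  by_contra! hosc
  have step : ∀ (n : ℕ) (q : {q : Finset X × Set X // IsOpen q.2 ∧ q.2.Nonempty}),
      ∃ (i j : ι) (x : X) (q' : {q : Finset X × Set X // IsOpen q.2 ∧ q.2.Nonempty}),
        (∀ z ∈ q.1.1, |h i z - h j z| < 1 / ((n : ℝ) + 1)) ∧ closure q'.1.2 ⊆ q.1.2 ∧
        (∀ z ∈ closure q'.1.2, ε / 3 ≤ |h i z - h j z|) ∧ x ∈ q'.1.2 ∧
        q.1.1 ⊆ q'.1.1 ∧ x ∈ q'.1.1 := by
    classical
    rintro n ⟨⟨s, V⟩, hV, hVne⟩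
    obtain ⟨i, j, hs, U, hU, ⟨x, hx⟩, hUV, hfar⟩ := exists_close_on_finset_far_on_open h hM
      (div_pos hε three_pos) (Nat.one_div_pos_of_nat (n := n))
      (by simpa only [mul_div_cancel₀ ε three_ne_zero] using hosc) s hV hVne
    exact ⟨i, j, x, ⟨(insert x s, U), hU, x, hx⟩, hs, hUV, hfar, hx,
      Finset.subset_insert _ _, Finset.mem_insert_self _ _⟩
  choose i j x q' hclose hcl hfar hxU hsub hxs using step
  let Q : ℕ → {q : Finset X × Set X // IsOpen q.2 ∧ q.2.Nonempty} :=
    fun n => Nat.rec ⟨(∅, univ), isOpen_univ, univ_nonempty⟩ q' n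
  have hQs : Monotone fun n => (Q n).1.1 := monotone_nat_of_le_succ fun n => hsub n (Q n)
  have hQU : Antitone fun n => (Q n).1.2 :=
    antitone_nat_of_succ_le fun n => subset_closure.trans (hcl n (Q n))
  let ξ : ℕ → X := fun n => x n (Q n)
  let 𝒰 : Ultrafilter ℕ := hyperfilter ℕ
  have h𝒰 : (𝒰 : Filter ℕ) ≤ atTop := Nat.hyperfilter_le_atTop
  -- The limits `p` and `r` agree at every `ξ m`, since later pairs are ever closer there. At a
  -- cluster point `z` of `ξ`, which lies in all the nested closures, they differ by at least `ε /
  -- 3`, contradicting continuity.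
  obtain ⟨p, hp⟩ := hlim (𝒰.map fun n => i n (Q n))
  obtain ⟨r, hr⟩ := hlim (𝒰.map fun n => j n (Q n))
  simp only [Ultrafilter.coe_map, tendsto_map'_iff] at hp hr
  have hdiff : ∀ z, Tendsto (fun n => |h (i n (Q n)) z - h (j n (Q n)) z|) 𝒰 (𝓝 |p z - r z|) :=
    fun z => ((hp z).sub (hr z)).abs
  have hpr : ∀ m, |p (ξ m) - r (ξ m)| ≤ 0 := fun m =>
    le_of_tendsto_of_tendsto (hdiff (ξ m)) (tendsto_one_div_add_atTop_nhds_zero_nat.mono_left h𝒰)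
      (h𝒰 ((eventually_gt_atTop m).mono fun n hn =>
        (hclose n (Q n) _ (hQs (Nat.succ_le_of_lt hn) (hxs m (Q m)))).le))
  obtain ⟨z, -, hz⟩ := isCompact_univ.ultrafilter_le_nhds (𝒰.map ξ) (by simp)
  have hzξ : Tendsto ξ 𝒰 (𝓝 z) := hz
  have hzcl : ∀ n, z ∈ closure (Q (n + 1)).1.2 := fun n =>
    mem_closure_of_tendsto hzξ (h𝒰 ((eventually_ge_atTop n).mono fun m hm =>
      hQU (Nat.succ_le_succ hm) (hxU m (Q m))))
  have h₁ : ε / 3 ≤ |p z - r z| :=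
    ge_of_tendsto' (hdiff z) fun n => hfar n (Q n) z (hzcl n)
  have h₂ : |p z - r z| ≤ 0 :=
    le_of_tendsto' ((((p - r).continuous.abs).tendsto z).comp hzξ) hpr
  linarith

section

variable {T X : Type*} [Monoid T] [TopologicalSpace T] [MulAction T X]

theorem IsWeaklyAlmostPeriodic.exists_tendsto [TopologicalSpace X] [ContinuousSMul T X]
    (hWAP : IsWeaklyAlmostPeriodic T X) (f : C(X, ℝ)) (𝒰 : Ultrafilter T) :
    ∃ g : C(X, ℝ), ∀ x, Tendsto (fun t => translate f t x) (𝒰 : Filter T) (𝓝 (g x)) := by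
  let _ : TopologicalSpace C(X, ℝ) := pointwiseTopology X
  obtain ⟨g, -, hg⟩ := (hWAP f).ultrafilter_le_nhds (𝒰.map (translate f)) (by
    rw [le_principal_iff]
    exact mem_of_superset (by simp) subset_closure)
  refine ⟨g, fun x => ?_⟩
  have hev : Continuous fun k : C(X, ℝ) => k x :=
    (continuous_apply x).comp (continuous_induced_dom (f := fun (k : C(X, ℝ)) (y : X) => k y))
  exact (hev.tendsto g).comp (f := translate f) hg

theorem IsWeaklyAlmostPeriodic.exists_open_oscillation_le [TopologicalSpace X]
    [ContinuousSMul T X] [CompactSpace X] [RegularSpace X] [Nonempty X]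
    (hWAP : IsWeaklyAlmostPeriodic T X) (f : C(X, ℝ)) {ε : ℝ} (hε : 0 < ε) :
    ∃ W : Set X, IsOpen W ∧ W.Nonempty ∧
      ∀ t : T, ∀ x ∈ W, ∀ y ∈ W, |f (t • x) - f (t • y)| ≤ ε :=
  WAPSemiflow.exists_open_oscillation_le (translate f) (M := ‖f‖)
    (fun t x => f.norm_coe_le_norm (t • x)) (hWAP.exists_tendsto f) hε

theorem IsSyndetic.nonempty {A : Set T} (hA : IsSyndetic A) : A.Nonempty := by
  obtain ⟨K, -, hK⟩ := hA
  exact (hK 1).mono inter_subset_right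

theorem isMinimal_of_isSyndeticallyTransitive [TopologicalSpace X] [ContinuousSMul T X]
    [CompactSpace X] [T2Space X] (hST : IsSyndeticallyTransitive T X)
    (hWAP : IsWeaklyAlmostPeriodic T X) : MulAction.IsMinimal T X := by
  refine ⟨fun z => ?_⟩
  by_contra hz
  obtain ⟨b, hb⟩ := not_forall.1 hz
  obtain ⟨f, hf0, hf1, -⟩ := exists_continuous_zero_one_of_isClosed isClosed_closure
    (isClosed_singleton (x := b)) (disjoint_singleton_right.2 hb)
  have : Nonempty X := ⟨z⟩
  obtain ⟨U, hU, hUne, hosc⟩ := hWAP.exists_open_oscillation_le f (ε := 1 / 3) (by norm_num)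
  have hfb : f b = 1 := hf1 rfl
  obtain ⟨K, hK, hsynd⟩ := hST U {x | 2 / 3 < f x} hU
    (isOpen_lt continuous_const f.continuous) hUne ⟨b, by norm_num [hfb]⟩
  have hKz : ∀ᶠ y in 𝓝 z, ∀ k ∈ K, f (k • y) < 1 / 3 := by
    refine hK.eventually_forall_of_forall_eventually fun k _ => ?_
    have hc : Continuous fun w : X × T => f (w.2 • w.1) := by fun_prop
    refine hc.continuousAt.eventually_lt continuousAt_const ?_
    have : f (k • z) = 0 := hf0 (subset_closure (MulAction.mem_orbit z k))
    norm_num [this]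
  obtain ⟨W, hW, hWo, hzW⟩ := eventually_nhds_iff.1 hKz
  -- One `t` brings `u'` near `z`, so `f (k t u') < 1 / 3` for every `k ∈ K`; syndeticity supplies
  -- `k ∈ K` and `u ∈ U` with `f (k t u) > 2 / 3`. The gap exceeds the oscillation allowed on `U`.
  obtain ⟨t, u', hu', htu'⟩ := (hST U W hU hWo hUne ⟨z, hzW⟩).nonempty
  obtain ⟨_, ⟨k, hk, rfl⟩, u, hu, hku⟩ := hsynd t
  have h₁ := hW _ htu' k hk
  have h₂ := (abs_le.1 (hosc (k * t) u hu u' hu')).2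
  simp only [mul_smul, mem_preimage, mem_ofPred_eq] at h₁ h₂ hku
  linarith

theorem IsRightCSemigroup.eventually_forall_abs_sub_le [TopologicalSpace X] [ContinuousSMul T X]
    [CompactSpace X] [RegularSpace X] [MulAction.IsMinimal T X] (hC : IsRightCSemigroup T)
    (hWAP : IsWeaklyAlmostPeriodic T X) (f : C(X, ℝ)) (x : X) {ε : ℝ} (hε : 0 < ε) :
    ∀ᶠ y in 𝓝 x, ∀ t : T, |f (t • x) - f (t • y)| ≤ ε := by
  have : Nonempty X := ⟨x⟩
  obtain ⟨W, hW, hWne, hosc⟩ := hWAP.exists_open_oscillation_le f hε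
  obtain ⟨s, hs⟩ := hW.exists_smul_mem T x hWne
  have hK : ∀ᶠ y in 𝓝 x, ∀ t ∈ closure (range fun t : T => t * s)ᶜ,
      |f (t • x) - f (t • y)| < ε := by
    refine (hC s).eventually_forall_of_forall_eventually fun t _ => ?_
    have hc : Continuous fun w : X × T => |f (w.2 • x) - f (w.2 • w.1)| := by fun_prop
    exact hc.continuousAt.eventually_lt continuousAt_const (by simpa using hε)
  filter_upwards [hK, (continuous_const_smul s).continuousAt.preimage_mem_nhds (hW.mem_nhds hs)]
    with y hy hsy t
  by_cases ht : t ∈ range fun t : T => t * s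
  · obtain ⟨r, rfl⟩ := ht
    simpa only [mul_smul] using hosc r _ hs _ hsy
  · exact (hy t (subset_closure ht)).le

end

/-- On a compact Hausdorff space, equicontinuity may be tested on real continuous functions. -/
theorem equicontinuousAt_of_forall_continuousMap {ι Y X : Type*} [TopologicalSpace Y]
    [UniformSpace X] [CompactSpace X] [T2Space X] (F : ι → Y → X) (y₀ : Y)
    (hF : ∀ (f : C(X, ℝ)) (ε : ℝ), 0 < ε →
      ∀ᶠ y in 𝓝 y₀, ∀ i, |f (F i y₀) - f (F i y)| ≤ ε) :
    EquicontinuousAt F y₀ := by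
  intro V hV
  by_contra hne
  let G : ι × Y → X × X := fun w => (F w.1 y₀, F w.1 w.2)
  have hfreq : ∃ᶠ w in comap Prod.snd (𝓝 y₀), G w ∉ V := by
    intro hev
    refine hne ?_
    filter_upwards [eventually_comap.1 hev] with y hy i
    exact not_not.1 (hy (i, y) rfl)
  have := frequently_iff_neBot.1 hfreq
  -- Bad pairs cluster at some `(a, b)`: if `a ≠ b`, a Urysohn function violates `hF`; if `a = b`,
  -- the pairs eventually enter `V`.
  let 𝒰 := Ultrafilter.of (comap Prod.snd (𝓝 y₀) ⊓ 𝓟 {w | G w ∉ V})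
  have h𝒰 : ↑𝒰 ≤ comap Prod.snd (𝓝 y₀) ⊓ 𝓟 {w : ι × Y | G w ∉ V} := Ultrafilter.of_le _
  obtain ⟨⟨a, b⟩, -, hab⟩ := isCompact_univ.ultrafilter_le_nhds (𝒰.map G) (by simp)
  have hG : Tendsto G 𝒰 (𝓝 (a, b)) := hab
  have hVab : ∀ᶠ w in (𝒰 : Filter (ι × Y)), G w ∉ V := h𝒰 (mem_inf_of_right (mem_principal_self _))
  obtain hne' | rfl := ne_or_eq a b
  · obtain ⟨f, hfa, hfb, -⟩ := exists_continuous_zero_one_of_isClosed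
      (isClosed_singleton (x := a)) (isClosed_singleton (x := b)) (disjoint_singleton.2 hne')
    have hfa : f a = 0 := hfa rfl
    have hfb : f b = 1 := hfb rfl
    have hc : Continuous fun v : X × X => |f v.1 - f v.2| := by fun_prop
    have hle : |f a - f b| ≤ 1 / 2 := by
      refine le_of_tendsto ((hc.tendsto (a, b)).comp hG) ?_
      have := (hF f (1 / 2) (by norm_num)).comap (Prod.snd : ι × Y → Y)
      exact (this.filter_mono (h𝒰.trans inf_le_left)).mono fun w hw => hw w.1
    norm_num [hfa, hfb] at hle
  · have hmem : V ∈ 𝓝 (a, a) := nhds_le_uniformity a hV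
    obtain ⟨w, hw₁, hw₂⟩ := (hVab.and (hG hmem)).exists
    exact hw₁ hw₂

end WAPSemiflow

theorem mainTheorem5 (T : Type*) [Monoid T] [TopologicalSpace T] [ContinuousMul T]
    (X : Type*) [UniformSpace X] [CompactSpace X] [T2Space X]
    [MulAction T X] [ContinuousSMul T X]
    (hC : WAPSemiflow.IsRightCSemigroup T)
    (hST : WAPSemiflow.IsSyndeticallyTransitive T X)
    (hWAP : WAPSemiflow.IsWeaklyAlmostPeriodic T X) :
    MulAction.IsMinimal T X ∧ UniformEquicontinuous (fun (t : T) (x : X) => t • x) := by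
  have hmin := WAPSemiflow.isMinimal_of_isSyndeticallyTransitive hST hWAP
  refine ⟨hmin, CompactSpace.uniformEquicontinuous_of_equicontinuous fun x => ?_⟩
  exact WAPSemiflow.equicontinuousAt_of_forall_continuousMap _ x fun f ε hε =>
    hC.eventually_forall_abs_sub_le hWAP f x hε
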